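/- Conventions. An $F$-inverse monoid is an inverse monoid $S$ in which every class of the minimum group congruence $\sigma$ has a greatest element in the natural partial order; it is viewed in the signature $(\cdot,1,{}^{-1},{}^{\mathfrak m})$, where $a^{\mathfrak m}$ is the greatest element of the $\sigma$-class of $a$. Let $X$ be a set and let $\mathbb{I}\mathfrak{m}_X$ be the set of formal terms $w=u_0v_1^{\mathfrak m}u_1\cdots v_n^{\mathfrak m}u_n$ with $n\ge 0$ and words $u_i,v_i\in(X\cup X^{-1})^*$. Let $R$ be a symmetric relation on $\mathbb{I}\mathfrak{m}_X$, let $S=\operatorname{FInv}\langle X\mid R\rangle$ be the $F$-inverse monoid it presents (the quotient of the free $F$-inverse monoid on $X$ by the congruence generated by $R$), let $G=S/\sigma$ be its greatest group image, and let $\Gamma_X$ be the Cayley graph of $G$ with respect to $X$. Write $w_S$ and $w_G$ for the values of a term $w$ in $S$ and in $G$ (in $G$, ${}^{\mathfrak m}$ is the identity map). A subgraph of $\Gamma_X$ is a set of vertices and edges closed under initial vertices, terminal vertices and inverse edges; it need not be connected. For $g\in G$, the journey labeled by $w=u_0v_1^{\mathfrak m}u_1\cdots v_n^{\mathfrak m}u_n$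 starting at $g$ is the sequence of paths in $\Gamma_X$ labeled by $u_0,u_1,\dots,u_n$ and starting at the vertices $g,\ g(u_0v_1)_G,\ \dots,\ g(u_0v_1\cdots u_{n-1}v_n)_G$ respectively; it leads from $g$ to $gw_G$. The subgraph it spans is the union of the subgraphs spanned by these paths, and the journey is in a subgraph $\Delta$ if that span is contained in $\Delta$. Let $\overline w$ be the journey labeled by $w$ starting at $1$, and $\langle\overline w\rangle$ the subgraph it spans. For a symmetric relation $Q$ on $\mathbb{I}\mathfrak{m}_X$ with $u_G=v_G$ whenever $(u,v)\in Q$, a subgraph $\Delta$ is $c_Q$-closed if for all $(u,v)\in Q$ and all vertices $g,h$ of $\Delta$, $u$ labels a journey in $\Delta$ from $g$ to $h$ if and only if $v$ does; $\Delta^{c_Q}$ denotes the intersection of all $c_Q$-closed subgraphs containing $\Delta$. Write $c_S$ for $c_Q$ with $Q=\{(u,v): u_S=v_S\}$. The $F$-Schützenberger graph of $w$ is $F\Gamma(w)=\langle\overline w\rangle^{c_S}$. The full $P$-expansion of $\Delta$ with respect to $R$ is the union of $\Delta$ and all subgraphs spanned by a journey labeled by $v$ starting at $g$ that is not in $\Delta$,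 where $g\in G$, $(u,v)\in R$ and the journey labeled by $u$ starting at $g$ is in $\Delta$. Theorem. For every $w\in\mathbb{I}\mathfrak{m}_X$, $F\Gamma(w)=\langle\overline w\rangle^{c_R}$, and this is the smallest $c_R$-closed subgraph of $\Gamma_X$ containing $\overline w$. Furthermore, $F\Gamma(w)=\bigcup_{i=1}^{\infty}\Delta_i$, where $\Delta_0=\langle\overline w\rangle$ and, for $i\ge 0$, $\Delta_{i+1}$ is the full $P$-expansion of $\Delta_i$ with respect to $R$. -/

import Mathlib

namespace FInvPres

universe u v

/-! ### Inverse monoids and the minimum group congruence -/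

/-- An inverse monoid: every element `a` has a unique (von Neumann) inverse `a⁻¹`. -/
class InverseMonoid (S : Type u) extends Monoid S, Inv S where
  mul_inv_mul : ∀ a : S, a * a⁻¹ * a = a
  inv_mul_inv : ∀ a : S, a⁻¹ * a * a⁻¹ = a⁻¹
  inv_unique : ∀ a b : S, a * b * a = a → b * a * b = b → b = a⁻¹

namespace InverseMonoid

variable {S : Type u} [InverseMonoid S]

/-- The natural partial order: `a ≤ b` iff `a = e b` for some idempotent `e`. -/
def NatLE (a b : S) : Prop := ∃ e : S, e * e = e ∧ a = e * b

/-- The relation `σ`: `a σ b` iff `e a = e b` for some idempotent `e`. -/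
def Sigma (a b : S) : Prop := ∃ e : S, e * e = e ∧ e * a = e * b

theorem inv_of_idem {e : S} (he : e * e = e) : e⁻¹ = e :=
  (inv_unique e e (by rw [he, he]) (by rw [he, he])).symm

theorem inv_inv' (a : S) : a⁻¹⁻¹ = a :=
  (inv_unique a⁻¹ a (inv_mul_inv a) (mul_inv_mul a)).symm

theorem idem_mul_idem {e f : S} (he : e * e = e) (hf : f * f = f) :
    e * f * (e * f) = e * f := by
  have h1 := mul_inv_mul (e * f)
  have h2 := inv_mul_inv (e * f)
  generalize hx : (e * f)⁻¹ = x at h1 h2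
  have key : f * x * e = x := by
    rw [← hx]
    refine inv_unique (e * f) _ ?_ ?_ <;> rw [hx]
    · calc e * f * (f * x * e) * (e * f) = e * (f * f) * x * (e * e) * f := by
            simp only [mul_assoc]
        _ = e * f * x * (e * f) := by rw [he, hf]; simp only [mul_assoc]
        _ = e * f := h1
    · calc f * x * e * (e * f) * (f * x * e) = f * (x * (e * e) * (f * f) * x) * e := by
            simp only [mul_assoc]
        _ = f * (x * (e * f) * x) * e := by rw [he, hf]; simp only [mul_assoc]
        _ = f * x * e := by rw [h2]
  have hxx : x * x = x := by
    calc x * x = f * x * e * (f * x * e) := by rw [key]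
      _ = f * (x * (e * f) * x) * e := by simp only [mul_assoc]
      _ = x := by rw [h2, key]
  have : e * f = x := by
    rw [← inv_inv' (e * f), hx, inv_of_idem hxx]
  rw [this, hxx]

theorem idem_comm {e f : S} (he : e * e = e) (hf : f * f = f) : e * f = f * e := by
  have h1 := idem_mul_idem he hf
  have h2 := idem_mul_idem hf he
  have h3 : f * e = (e * f)⁻¹ := by
    refine inv_unique (e * f) (f * e) ?_ ?_
    · calc e * f * (f * e) * (e * f) = e * (f * f) * (e * e) * f := by simp only [mul_assoc]
        _ = e * f * (e * f) := by rw [he, hf]; simp only [mul_assoc]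
        _ = e * f := h1
    · calc f * e * (e * f) * (f * e) = f * (e * e) * (f * f) * e := by simp only [mul_assoc]
        _ = f * e * (f * e) := by rw [he, hf]; simp only [mul_assoc]
        _ = f * e := h2
  rw [h3, inv_of_idem h1]

theorem mul_inv_idem (a : S) : a * a⁻¹ * (a * a⁻¹) = a * a⁻¹ := by
  rw [← mul_assoc, mul_inv_mul]

theorem inv_mul_idem (a : S) : a⁻¹ * a * (a⁻¹ * a) = a⁻¹ * a := by
  rw [← mul_assoc, inv_mul_inv]

theorem mul_inv_rev' (a b : S) : (a * b)⁻¹ = b⁻¹ * a⁻¹ := by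
  have hc := idem_comm (mul_inv_idem b) (inv_mul_idem a)
  refine (inv_unique (a * b) (b⁻¹ * a⁻¹) ?_ ?_).symm
  · calc a * b * (b⁻¹ * a⁻¹) * (a * b) = a * (b * b⁻¹ * (a⁻¹ * a)) * b := by
          simp only [mul_assoc]
      _ = a * a⁻¹ * a * (b * b⁻¹ * b) := by rw [hc]; simp only [mul_assoc]
      _ = a * b := by rw [mul_inv_mul, mul_inv_mul]
  · calc b⁻¹ * a⁻¹ * (a * b) * (b⁻¹ * a⁻¹) = b⁻¹ * (a⁻¹ * a * (b * b⁻¹)) * a⁻¹ := by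
          simp only [mul_assoc]
      _ = b⁻¹ * b * b⁻¹ * (a⁻¹ * a * a⁻¹) := by rw [← hc]; simp only [mul_assoc]
      _ = b⁻¹ * a⁻¹ := by rw [inv_mul_inv, inv_mul_inv]

theorem conj_idem (a : S) {f : S} (hf : f * f = f) :
    a * f * a⁻¹ * (a * f * a⁻¹) = a * f * a⁻¹ := by
  have hc := idem_comm hf (inv_mul_idem a)
  calc a * f * a⁻¹ * (a * f * a⁻¹) = a * (f * (a⁻¹ * a)) * f * a⁻¹ := by simp only [mul_assoc]
    _ = a * a⁻¹ * a * (f * f) * a⁻¹ := by rw [hc]; simp only [mul_assoc]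
    _ = a * f * a⁻¹ := by rw [mul_inv_mul, hf]

theorem conj_mul (a : S) {f : S} (hf : f * f = f) : a * f * a⁻¹ * a = a * f := by
  have hc := idem_comm hf (inv_mul_idem a)
  calc a * f * a⁻¹ * a = a * (f * (a⁻¹ * a)) := by simp only [mul_assoc]
    _ = a * a⁻¹ * a * f := by rw [hc]; simp only [mul_assoc]
    _ = a * f := by rw [mul_inv_mul]

theorem natLE_antisymm {a b : S} (h1 : NatLE a b) (h2 : NatLE b a) : a = b := by
  obtain ⟨e, he, hab⟩ := h1
  obtain ⟨f, hf, hba⟩ := h2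
  have hea : e * a = a := by rw [hab, ← mul_assoc, he]
  calc a = e * (f * a) := by rw [← hba, hab]
    _ = f * (e * a) := by rw [← mul_assoc, idem_comm he hf, mul_assoc]
    _ = b := by rw [hea, hba]

theorem sigma_refl (a : S) : Sigma a a := ⟨1, one_mul 1, rfl⟩

theorem sigma_symm {a b : S} : Sigma a b → Sigma b a
  | ⟨e, he, h⟩ => ⟨e, he, h.symm⟩

theorem sigma_trans {a b c : S} (h1 : Sigma a b) (h2 : Sigma b c) : Sigma a c := by
  obtain ⟨e, he, hab⟩ := h1
  obtain ⟨f, hf, hbc⟩ := h2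
  refine ⟨e * f, idem_mul_idem he hf, ?_⟩
  rw [idem_comm he hf, mul_assoc, hab, ← mul_assoc, ← idem_comm he hf, mul_assoc, hbc, mul_assoc]

theorem sigma_mul_left (a : S) {c d : S} (h : Sigma c d) : Sigma (a * c) (a * d) := by
  obtain ⟨f, hf, hcd⟩ := h
  refine ⟨a * f * a⁻¹, conj_idem a hf, ?_⟩
  rw [← mul_assoc, ← mul_assoc, conj_mul a hf, mul_assoc, mul_assoc, hcd]

theorem sigma_mul_right {a b : S} (c : S) (h : Sigma a b) : Sigma (a * c) (b * c) := by
  obtain ⟨e, he, hab⟩ := h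
  exact ⟨e, he, by rw [← mul_assoc, ← mul_assoc, hab]⟩

/-- `σ` as a congruence. -/
def sigmaCon (S : Type u) [InverseMonoid S] : Con S where
  r := Sigma
  iseqv := ⟨sigma_refl, sigma_symm, sigma_trans⟩
  mul' := fun {_ b c _} h1 h2 => sigma_trans (sigma_mul_right c h1) (sigma_mul_left b h2)

theorem sigma_inv_mul (a : S) : Sigma (a⁻¹ * a) 1 :=
  ⟨a⁻¹ * a, inv_mul_idem a, by rw [inv_mul_idem, mul_one]⟩

theorem sigma_mul_inv (a : S) : Sigma (a * a⁻¹) 1 :=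
  ⟨a * a⁻¹, mul_inv_idem a, by rw [mul_inv_idem, mul_one]⟩

theorem sigma_inv {a b : S} (h : Sigma a b) : Sigma a⁻¹ b⁻¹ := by
  have h1 : Sigma (a⁻¹ * (b * b⁻¹)) a⁻¹ := by
    simpa using sigma_mul_left a⁻¹ (sigma_mul_inv b)
  have h2 : Sigma (a⁻¹ * (a * b⁻¹)) (a⁻¹ * (b * b⁻¹)) :=
    sigma_mul_left _ (sigma_mul_right _ h)
  have h3 : Sigma (a⁻¹ * (a * b⁻¹)) b⁻¹ := by
    simpa [mul_assoc] using sigma_mul_right b⁻¹ (sigma_inv_mul a)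
  exact sigma_trans (sigma_symm (sigma_trans h2 h1)) h3

end InverseMonoid

open InverseMonoid

/-- The greatest group image `S / σ` of an inverse monoid. -/
def GroupImage (S : Type u) [InverseMonoid S] : Type u := (sigmaCon S).Quotient

/-- The natural projection `σ♯ : S → S / σ`. -/
def toGroupImage {S : Type u} [InverseMonoid S] (s : S) : GroupImage S :=
  Quotient.mk (sigmaCon S).toSetoid s

instance instGroupGroupImage (S : Type u) [InverseMonoid S] : Group (GroupImage S) where
  __ := (inferInstance : Monoid (sigmaCon S).Quotient)
  inv := Quotient.map (fun a : S => a⁻¹) (fun _ _ h => sigma_inv h)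
  inv_mul_cancel a := by
    induction a using Quotient.inductionOn with
    | _ a => exact Quotient.sound (sigma_inv_mul a)

theorem toGroupImage_eq_iff {S : Type u} [InverseMonoid S] {a b : S} :
    toGroupImage a = toGroupImage b ↔ Sigma a b :=
  ⟨fun h => Quotient.exact h, fun h => Quotient.sound h⟩

theorem toGroupImage_mul {S : Type u} [InverseMonoid S] (a b : S) :
    toGroupImage (a * b) = toGroupImage a * toGroupImage b := rfl

theorem toGroupImage_one {S : Type u} [InverseMonoid S] :
    toGroupImage (1 : S) = 1 := rfl

theorem toGroupImage_inv {S : Type u} [InverseMonoid S] (a : S) :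
    toGroupImage a⁻¹ = (toGroupImage a)⁻¹ := rfl

/-- `S / σ` is the greatest group image: every morphism to a group factors through it. -/
theorem map_eq_of_toGroupImage_eq {S : Type u} [InverseMonoid S] {H : Type v} [Group H]
    (f : S →* H) {a b : S} (h : toGroupImage a = toGroupImage b) : f a = f b := by
  obtain ⟨e, he, hab⟩ := toGroupImage_eq_iff.1 h
  have h1 : f e = 1 := by
    have := congrArg f he
    rwa [map_mul, mul_eq_left] at this
  simpa [h1] using congrArg f hab

/-! ### F-inverse monoids in the extended signature -/

/-- An `F`-inverse monoid: `m a` is the greatest element of the `σ`-class of `a`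
with respect to the natural partial order. -/
class FInverseMonoid (S : Type u) extends InverseMonoid S where
  m : S → S
  sigma_m : ∀ a : S, InverseMonoid.Sigma a (m a)
  le_m : ∀ a b : S, InverseMonoid.Sigma a b → InverseMonoid.NatLE b (m a)

namespace FInverseMonoid

variable {S : Type u} [FInverseMonoid S]

theorem m_eq_of_sigma {a b : S} (h : Sigma a b) : m a = m b :=
  natLE_antisymm (le_m b (m a) (sigma_trans (sigma_symm h) (sigma_m a)))
    (le_m a (m b) (sigma_trans h (sigma_m b)))

theorem mul_inv_mul_m (a : S) : a * a⁻¹ * m a = a := by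
  obtain ⟨e, he, h⟩ := le_m a a (sigma_refl a)
  have hea : e * a = a := by rw [h, ← mul_assoc, he]
  calc a * a⁻¹ * m a = e * (a * a⁻¹) * m a := by rw [← mul_assoc, hea]
    _ = a * a⁻¹ * (e * m a) := by rw [idem_comm he (mul_inv_idem a), mul_assoc]
    _ = a := by rw [← h, mul_inv_mul]

theorem m_absorb (a b : S) : m (a * a⁻¹ * b) = m b :=
  m_eq_of_sigma ⟨a * a⁻¹, mul_inv_idem a, by rw [← mul_assoc, mul_inv_idem]⟩

end FInverseMonoid

/-! ### Words and terms -/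

/-- The alphabet `X ∪ X⁻¹`: `(x, true)` stands for `x` and `(x, false)` for `x⁻¹`. -/
abbrev Letter (X : Type u) : Type u := X × Bool

/-- The formal inverse of a letter. -/
def Letter.inv {X : Type u} (a : Letter X) : Letter X := (a.1, !a.2)

/-- Words over `X ∪ X⁻¹`. -/
abbrev Word (X : Type u) : Type u := List (Letter X)

/-- The set of formal expressions `u₀ v₁ᵐ u₁ ⋯ vₙᵐ uₙ` with words `uᵢ, vᵢ`; here `head = u₀`
and `tail = [(v₁, u₁), …, (vₙ, uₙ)]`. -/
structure ImTerm (X : Type u) : Type u where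
  head : Word X
  tail : List (Word X × Word X)

section Values

variable {X : Type u} {M : Type v} [Monoid M] [Inv M]

/-- The value of a letter under an assignment `ι` of the generators. -/
def letterVal (ι : X → M) (a : Letter X) : M := if a.2 then ι a.1 else (ι a.1)⁻¹

/-- The value of a word. -/
def wordVal (ι : X → M) (w : Word X) : M := (w.map (letterVal ι)).prod

/-- The value of the term `u₀ v₁ᵐ u₁ ⋯ vₙᵐ uₙ` under an assignment `ι` of the generators, where `m`
is the interpretation of the unary operation. -/
def ImTerm.val (m : M → M) (ι : X → M) (w : ImTerm X) : M :=
  wordVal ι w.head * (w.tail.map fun p => m (wordVal ι p.1) * wordVal ι p.2).prod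

end Values

/-- The value `w_S` of a term in an `F`-inverse monoid `S` with generators `ι`. -/
def ImTerm.valS {X : Type u} {S : Type v} [FInverseMonoid S] (ι : X → S) (w : ImTerm X) : S :=
  w.val FInverseMonoid.m ι

/-- The value `w_G` of a term in a group `G` with generators `ι`; a group is an
`F`-inverse monoid where `m` is the identity map. -/
def ImTerm.valG {X : Type u} {G : Type v} [Group G] (ι : X → G) (w : ImTerm X) : G :=
  w.val id ι

/-- The generators of the greatest group image of `S` that are induced by those of `S`. -/
def groupGen {X : Type u} {S : Type v} [InverseMonoid S] (ι : X → S) : X → GroupImage S :=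
  fun x => toGroupImage (ι x)

section

variable {X : Type u} {S : Type v}

theorem wordVal_groupGen [InverseMonoid S] (ι : X → S) (w : Word X) :
    wordVal (groupGen ι) w = toGroupImage (wordVal ι w) := by
  induction w with
  | nil => rfl
  | cons a w ih =>
    have h1 : wordVal ι (a :: w) = letterVal ι a * wordVal ι w := by simp [wordVal]
    have h2 : wordVal (groupGen ι) (a :: w) =
        letterVal (groupGen ι) a * wordVal (groupGen ι) w := by simp [wordVal]
    rw [h1, h2, toGroupImage_mul, ih]
    congr 1
    unfold letterVal
    split <;> rfl

theorem toGroupImage_m [FInverseMonoid S] (a : S) :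
    toGroupImage (FInverseMonoid.m a) = toGroupImage a :=
  (toGroupImage_eq_iff.2 (FInverseMonoid.sigma_m a)).symm

theorem valG_groupGen [FInverseMonoid S] (ι : X → S) (w : ImTerm X) :
    w.valG (groupGen ι) = toGroupImage (w.valS ι) := by
  obtain ⟨u, t⟩ := w
  simp only [ImTerm.valG, ImTerm.valS, ImTerm.val, toGroupImage_mul, wordVal_groupGen]
  congr 1
  induction t with
  | nil => rfl
  | cons p t ih =>
    rw [List.map_cons, List.prod_cons, ih]
    simp only [List.map_cons, List.prod_cons, toGroupImage_mul, toGroupImage_m, id_eq]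

end

/-! ### Presentations -/

/-- Terms in the full signature `(·, 1, ⁻¹, ᵐ)`. -/
inductive FTerm (X : Type u) : Type u where
  | var : X → FTerm X
  | one : FTerm X
  | mul : FTerm X → FTerm X → FTerm X
  | inv : FTerm X → FTerm X
  | m : FTerm X → FTerm X

namespace FTerm

variable {X : Type u}

def ofLetter (a : Letter X) : FTerm X := if a.2 then var a.1 else inv (var a.1)

def ofWord : Word X → FTerm X
  | [] => one
  | a :: w => mul (ofLetter a) (ofWord w)

def ofTail : List (Word X × Word X) → FTerm X
  | [] => one
  | p :: t => mul (mul (m (ofWord p.1)) (ofWord p.2)) (ofTail t)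

/-- A formal expression `u₀ v₁ᵐ u₁ ⋯ vₙᵐ uₙ` as a term in the full signature. -/
def ofIm (w : ImTerm X) : FTerm X := mul (ofWord w.head) (ofTail w.tail)

/-- Evaluation in an `F`-inverse monoid. -/
def eval {S : Type v} [FInverseMonoid S] (ι : X → S) : FTerm X → S
  | var x => ι x
  | one => 1
  | mul s t => eval ι s * eval ι t
  | inv s => (eval ι s)⁻¹
  | m s => FInverseMonoid.m (eval ι s)

end FTerm

/-- The congruence on terms generated by the identities of the variety of `F`-inverse monoids
together with the pairs in `R`. -/
inductive FInvRel {X : Type u} (R : ImTerm X → ImTerm X → Prop) : FTerm X → FTerm X → Prop where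
  | refl (s) : FInvRel R s s
  | symm {s t} : FInvRel R s t → FInvRel R t s
  | trans {s t r} : FInvRel R s t → FInvRel R t r → FInvRel R s r
  | mul_congr {s s' t t'} : FInvRel R s s' → FInvRel R t t' → FInvRel R (.mul s t) (.mul s' t')
  | inv_congr {s s'} : FInvRel R s s' → FInvRel R (.inv s) (.inv s')
  | m_congr {s s'} : FInvRel R s s' → FInvRel R (.m s) (.m s')
  | mul_assoc (s t r) : FInvRel R (.mul (.mul s t) r) (.mul s (.mul t r))
  | one_mul (s) : FInvRel R (.mul .one s) s
  | mul_one (s) : FInvRel R (.mul s .one) s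
  | inv_inv (s) : FInvRel R (.inv (.inv s)) s
  | mul_inv_rev (s t) : FInvRel R (.inv (.mul s t)) (.mul (.inv t) (.inv s))
  | mul_inv_mul (s) : FInvRel R (.mul (.mul s (.inv s)) s) s
  | idem_comm (s t) : FInvRel R (.mul (.mul s (.inv s)) (.mul t (.inv t)))
      (.mul (.mul t (.inv t)) (.mul s (.inv s)))
  | mul_inv_mul_m (s) : FInvRel R (.mul (.mul s (.inv s)) (.m s)) s
  | m_absorb (s t) : FInvRel R (.m (.mul (.mul s (.inv s)) t)) (.m t)
  | rel {u v} : R u v → FInvRel R (.ofIm u) (.ofIm v)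

def FInvRel.setoid {X : Type u} (R : ImTerm X → ImTerm X → Prop) : Setoid (FTerm X) where
  r := FInvRel R
  iseqv := ⟨.refl, .symm, .trans⟩

/-- The `F`-inverse monoid `FInv⟨X | R⟩` presented by the generators `X` and the relations `R`. -/
def FInv {X : Type u} (R : ImTerm X → ImTerm X → Prop) : Type u := Quotient (FInvRel.setoid R)

namespace FInv

variable {X : Type u} {R : ImTerm X → ImTerm X → Prop}

/-- The class of a term. -/
def mk (R : ImTerm X → ImTerm X → Prop) (s : FTerm X) : FInv R := Quotient.mk _ s

/-- The canonical generators of `FInv⟨X | R⟩`. -/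
def gen (R : ImTerm X → ImTerm X → Prop) (x : X) : FInv R := mk R (.var x)

instance instMonoid : Monoid (FInv R) where
  mul := Quotient.map₂ FTerm.mul fun _ _ h1 _ _ h2 => FInvRel.mul_congr h1 h2
  one := mk R .one
  mul_assoc a b c := by
    induction a using Quotient.inductionOn
    induction b using Quotient.inductionOn
    induction c using Quotient.inductionOn
    exact Quotient.sound (FInvRel.mul_assoc _ _ _)
  one_mul a := by
    induction a using Quotient.inductionOn
    exact Quotient.sound (FInvRel.one_mul _)
  mul_one a := by
    induction a using Quotient.inductionOn
    exact Quotient.sound (FInvRel.mul_one _)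

instance instInv : Inv (FInv R) where
  inv := Quotient.map FTerm.inv fun _ _ h => FInvRel.inv_congr h

/-- The operation `ᵐ` on `FInv⟨X | R⟩`. -/
def opM : FInv R → FInv R := Quotient.map FTerm.m fun _ _ h => FInvRel.m_congr h

theorem inv_inv_eq (a : FInv R) : a⁻¹⁻¹ = a := by
  induction a using Quotient.inductionOn
  exact Quotient.sound (FInvRel.inv_inv _)

theorem mul_inv_rev_eq (a b : FInv R) : (a * b)⁻¹ = b⁻¹ * a⁻¹ := by
  induction a using Quotient.inductionOn
  induction b using Quotient.inductionOn
  exact Quotient.sound (FInvRel.mul_inv_rev _ _)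

theorem mul_inv_mul_eq (a : FInv R) : a * a⁻¹ * a = a := by
  induction a using Quotient.inductionOn
  exact Quotient.sound (FInvRel.mul_inv_mul _)

theorem idem_comm_eq (a b : FInv R) : a * a⁻¹ * (b * b⁻¹) = b * b⁻¹ * (a * a⁻¹) := by
  induction a using Quotient.inductionOn
  induction b using Quotient.inductionOn
  exact Quotient.sound (FInvRel.idem_comm _ _)

theorem mul_inv_mul_m_eq (a : FInv R) : a * a⁻¹ * opM a = a := by
  induction a using Quotient.inductionOn
  exact Quotient.sound (FInvRel.mul_inv_mul_m _)

theorem m_absorb_eq (a b : FInv R) : opM (a * a⁻¹ * b) = opM b := by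
  induction a using Quotient.inductionOn
  induction b using Quotient.inductionOn
  exact Quotient.sound (FInvRel.m_absorb _ _)

theorem inv_mul_inv_eq (a : FInv R) : a⁻¹ * a * a⁻¹ = a⁻¹ := by
  have := mul_inv_mul_eq a⁻¹
  rwa [inv_inv_eq] at this

theorem idem_eq {e : FInv R} (he : e * e = e) : e * e⁻¹ = e := by
  have hi : e⁻¹ * e⁻¹ = e⁻¹ := by rw [← mul_inv_rev_eq, he]
  have hc := idem_comm_eq e⁻¹ e
  rw [inv_inv_eq] at hc
  have h : e⁻¹ = e * e⁻¹ * e := by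
    calc e⁻¹ = e⁻¹ * e * (e * e⁻¹) := by
          rw [mul_assoc, ← mul_assoc e e, he, ← mul_assoc, inv_mul_inv_eq]
      _ = e * (e⁻¹ * e⁻¹) * e := by rw [hc]; simp only [mul_assoc]
      _ = e * e⁻¹ * e := by rw [hi]
  rw [mul_inv_mul_eq] at h
  rw [h, he]

instance instFInverseMonoid : FInverseMonoid (FInv R) where
  mul_inv_mul := mul_inv_mul_eq
  inv_mul_inv := inv_mul_inv_eq
  inv_unique a b h1 h2 := by
    have comm : ∀ {e f : FInv R}, e * e = e → f * f = f → e * f = f * e := by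
      intro e f he hf
      rw [← idem_eq he, ← idem_eq hf, idem_comm_eq]
    have i1 : a * b * (a * b) = a * b := by rw [← mul_assoc, h1]
    have i2 : a * a⁻¹ * (a * a⁻¹) = a * a⁻¹ := by rw [← mul_assoc, mul_inv_mul_eq]
    have i3 : b * a * (b * a) = b * a := by rw [← mul_assoc, h2]
    have i4 : a⁻¹ * a * (a⁻¹ * a) = a⁻¹ * a := by rw [← mul_assoc, inv_mul_inv_eq]
    have e1 : a * b = a * a⁻¹ := by
      calc a * b = a * a⁻¹ * (a * b) := by rw [← mul_assoc, mul_inv_mul_eq]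
        _ = a * b * (a * a⁻¹) := comm i2 i1
        _ = a * a⁻¹ := by rw [← mul_assoc, h1]
    have e2 : b * a = a⁻¹ * a := by
      calc b * a = b * a * (a⁻¹ * a) := by
            rw [mul_assoc, ← mul_assoc a, mul_inv_mul_eq]
        _ = a⁻¹ * a * (b * a) := comm i3 i4
        _ = a⁻¹ * a := by rw [mul_assoc, ← mul_assoc a, h1]
    calc b = b * a * b := h2.symm
      _ = a⁻¹ * (a * b) := by rw [e2, mul_assoc]
      _ = a⁻¹ := by rw [e1, ← mul_assoc, inv_mul_inv_eq]
  m := opM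
  sigma_m a := by
    refine ⟨a * a⁻¹, ?_, ?_⟩
    · rw [← mul_assoc, mul_inv_mul_eq]
    · rw [mul_inv_mul_m_eq, mul_inv_mul_eq]
  le_m a b h := by
    obtain ⟨e, he, hab⟩ := h
    have hm : opM a = opM b := by
      rw [← m_absorb_eq e a, ← m_absorb_eq e b, idem_eq he, hab]
    refine ⟨b * b⁻¹, ?_, ?_⟩
    · rw [← mul_assoc, mul_inv_mul_eq]
    · rw [hm, mul_inv_mul_m_eq]

theorem mk_ofWord (w : Word X) : mk R (.ofWord w) = wordVal (gen R) w := by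
  induction w with
  | nil => rfl
  | cons a w ih =>
    have h1 : wordVal (gen R) (a :: w) = letterVal (gen R) a * wordVal (gen R) w := by
      simp [wordVal]
    have h2 : mk R (.ofLetter a) = letterVal (gen R) a := by
      unfold FTerm.ofLetter letterVal
      split <;> rfl
    rw [h1, ← ih, ← h2]
    rfl

theorem mk_ofIm (w : ImTerm X) : mk R (.ofIm w) = w.valS (gen R) := by
  obtain ⟨u, t⟩ := w
  have ht : mk R (.ofTail t) =
      (t.map fun p => FInverseMonoid.m (wordVal (gen R) p.1) * wordVal (gen R) p.2).prod := by
    induction t with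
    | nil => rfl
    | cons p t ih =>
      rw [List.map_cons, List.prod_cons, ← ih, ← mk_ofWord, ← mk_ofWord]
      rfl
  rw [ImTerm.valS, ImTerm.val, ← ht, ← mk_ofWord]
  rfl

/-- `FInv⟨X | R⟩` is generated by `X`: every element is the value of a term. -/
theorem eval_gen (s : FTerm X) : FTerm.eval (gen R) s = mk R s := by
  induction s with
  | var => rfl
  | one => rfl
  | mul s t ih1 ih2 => rw [FTerm.eval, ih1, ih2]; rfl
  | inv s ih => rw [FTerm.eval, ih]; rfl
  | m s ih => rw [FTerm.eval, ih]; rfl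

/-- The relations hold in `FInv⟨X | R⟩`. -/
theorem valS_eq {u v : ImTerm X} (h : R u v) : u.valS (gen R) = v.valS (gen R) := by
  rw [← mk_ofIm, ← mk_ofIm]
  exact Quotient.sound (FInvRel.rel h)

/-- The relations hold in the greatest group image of `FInv⟨X | R⟩`. -/
theorem valG_eq (u v : ImTerm X) (h : R u v) :
    u.valG (groupGen (gen R)) = v.valG (groupGen (gen R)) := by
  rw [valG_groupGen, valG_groupGen, valS_eq h]

/-- The universal property of the presentation: terms that are equal in `FInv⟨X | R⟩` are equal in
every `F`-inverse monoid that satisfies the relations. -/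
theorem eval_eq {S : Type v} [FInverseMonoid S] (ι : X → S)
    (hι : ∀ u v, R u v → FTerm.eval ι (.ofIm u) = FTerm.eval ι (.ofIm v)) {s t : FTerm X}
    (h : mk R s = mk R t) : FTerm.eval ι s = FTerm.eval ι t := by
  have h' : FInvRel R s t := Quotient.exact h
  clear h
  induction h' with
  | refl => rfl
  | symm _ ih => exact ih.symm
  | trans _ _ ih1 ih2 => exact ih1.trans ih2
  | mul_congr _ _ ih1 ih2 => simp only [FTerm.eval, ih1, ih2]
  | inv_congr _ ih => simp only [FTerm.eval, ih]
  | m_congr _ ih => simp only [FTerm.eval, ih]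
  | mul_assoc => exact _root_.mul_assoc _ _ _
  | one_mul => exact _root_.one_mul _
  | mul_one => exact _root_.mul_one _
  | inv_inv => exact InverseMonoid.inv_inv' _
  | mul_inv_rev => exact InverseMonoid.mul_inv_rev' _ _
  | mul_inv_mul => exact InverseMonoid.mul_inv_mul _
  | idem_comm => exact InverseMonoid.idem_comm (mul_inv_idem _) (mul_inv_idem _)
  | mul_inv_mul_m => exact FInverseMonoid.mul_inv_mul_m _
  | m_absorb => exact FInverseMonoid.m_absorb _ _
  | rel h => exact hι _ _ h

end FInv

/-! ### The Cayley graph of a group and its subgraphs -/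

section Cayley

variable {X : Type u} {G : Type v} [Group G]

/-- Edges of the Cayley graph of `G` with respect to `ι : X → G`: for each `g` in `G` and each
letter `a` in `X ∪ X⁻¹` there is one edge from `g` to `g * a_G`. The vertex set is `G`. -/
@[ext] structure Edge (ι : X → G) : Type (max u v) where
  src : G
  label : Letter X

namespace Edge

variable {ι : X → G}

def tgt (e : Edge ι) : G := e.src * letterVal ι e.label

/-- The inverse edge. -/
def inv (e : Edge ι) : Edge ι := ⟨e.tgt, e.label.inv⟩

theorem letterVal_inv (a : Letter X) : letterVal ι a.inv = (letterVal ι a)⁻¹ := by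
  obtain ⟨x, b⟩ := a
  cases b <;> simp [letterVal, Letter.inv]

theorem tgt_inv (e : Edge ι) : e.inv.tgt = e.src := by
  simp [inv, tgt, letterVal_inv]

theorem inv_inv (e : Edge ι) : e.inv.inv = e := by
  ext1
  · exact tgt_inv e
  · simp [inv, Letter.inv]

end Edge

/-- Subgraphs of the Cayley graph: sets of vertices and edges closed under initial vertices,
terminal vertices and inverse edges (not necessarily connected). -/
@[ext] structure Sub (ι : X → G) : Type (max u v) where
  verts : Set G
  edges : Set (Edge ι)
  src_mem : ∀ e ∈ edges, e.src ∈ verts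
  tgt_mem : ∀ e ∈ edges, e.tgt ∈ verts
  inv_mem : ∀ e ∈ edges, e.inv ∈ edges

namespace Sub

variable {ι : X → G}

instance instPartialOrder : PartialOrder (Sub ι) :=
  PartialOrder.lift (fun D => (D.verts, D.edges)) fun D E h => by
    simp only [Prod.mk.injEq] at h
    exact Sub.ext h.1 h.2

theorem le_def {D E : Sub ι} : D ≤ E ↔ D.verts ⊆ E.verts ∧ D.edges ⊆ E.edges := Iff.rfl

/-- The complete lattice of subgraphs, with respect to union and intersection of the vertex sets and
of the edge sets. -/
instance instCompleteLattice : CompleteLattice (Sub ι) where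
  sup D E :=
    { verts := D.verts ∪ E.verts
      edges := D.edges ∪ E.edges
      src_mem := fun e he => he.imp (D.src_mem e) (E.src_mem e)
      tgt_mem := fun e he => he.imp (D.tgt_mem e) (E.tgt_mem e)
      inv_mem := fun e he => he.imp (D.inv_mem e) (E.inv_mem e) }
  le_sup_left _ _ := ⟨Set.subset_union_left, Set.subset_union_left⟩
  le_sup_right _ _ := ⟨Set.subset_union_right, Set.subset_union_right⟩
  sup_le _ _ _ h1 h2 := ⟨Set.union_subset h1.1 h2.1, Set.union_subset h1.2 h2.2⟩
  inf D E :=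
    { verts := D.verts ∩ E.verts
      edges := D.edges ∩ E.edges
      src_mem := fun e he => ⟨D.src_mem e he.1, E.src_mem e he.2⟩
      tgt_mem := fun e he => ⟨D.tgt_mem e he.1, E.tgt_mem e he.2⟩
      inv_mem := fun e he => ⟨D.inv_mem e he.1, E.inv_mem e he.2⟩ }
  inf_le_left _ _ := ⟨Set.inter_subset_left, Set.inter_subset_left⟩
  inf_le_right _ _ := ⟨Set.inter_subset_right, Set.inter_subset_right⟩
  le_inf _ _ _ h1 h2 := ⟨Set.subset_inter h1.1 h2.1, Set.subset_inter h1.2 h2.2⟩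
  sSup A :=
    { verts := {g | ∃ D ∈ A, g ∈ D.verts}
      edges := {e | ∃ D ∈ A, e ∈ D.edges}
      src_mem := fun e ⟨D, hD, he⟩ => ⟨D, hD, D.src_mem e he⟩
      tgt_mem := fun e ⟨D, hD, he⟩ => ⟨D, hD, D.tgt_mem e he⟩
      inv_mem := fun e ⟨D, hD, he⟩ => ⟨D, hD, D.inv_mem e he⟩ }
  isLUB_sSup _ :=
    ⟨fun D hD => ⟨fun _ h => ⟨D, hD, h⟩, fun _ h => ⟨D, hD, h⟩⟩,
     fun _ hE => ⟨fun _ ⟨_, hD, h⟩ => (hE hD).1 h, fun _ ⟨_, hD, h⟩ => (hE hD).2 h⟩⟩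
  sInf A :=
    { verts := {g | ∀ D ∈ A, g ∈ D.verts}
      edges := {e | ∀ D ∈ A, e ∈ D.edges}
      src_mem := fun e he D hD => D.src_mem e (he D hD)
      tgt_mem := fun e he D hD => D.tgt_mem e (he D hD)
      inv_mem := fun e he D hD => D.inv_mem e (he D hD) }
  isGLB_sInf _ :=
    ⟨fun D hD => ⟨fun _ h => h D hD, fun _ h => h D hD⟩,
     fun _ hE => ⟨fun _ h _ hD => (hE hD).1 h, fun _ h _ hD => (hE hD).2 h⟩⟩
  top := ⟨Set.univ, Set.univ, fun _ _ => trivial, fun _ _ => trivial, fun _ _ => trivial⟩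
  le_top _ := ⟨Set.subset_univ _, Set.subset_univ _⟩
  bot := ⟨∅, ∅, fun _ h => h.elim, fun _ h => h.elim, fun _ h => h.elim⟩
  bot_le _ := ⟨Set.empty_subset _, Set.empty_subset _⟩

end Sub

/-! ### Paths and journeys -/

/-- `Consecutive g l`: the edges in `l` form a path that starts at `g`. -/
def Consecutive {ι : X → G} : G → List (Edge ι) → Prop
  | _, [] => True
  | g, e :: l => e.src = g ∧ Consecutive e.tgt l

/-- The terminal vertex of the path with initial vertex `g` and edges `l`. -/
def pathEnd {ι : X → G} : G → List (Edge ι) → G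
  | g, [] => g
  | _, e :: l => pathEnd e.tgt l

/-- A path in the Cayley graph: an initial vertex and a (possibly empty) list of consecutive
edges. -/
structure Path (ι : X → G) : Type (max u v) where
  start : G
  edges : List (Edge ι)
  consecutive : Consecutive start edges

/-- The terminal vertex of a path. -/
def Path.finish {ι : X → G} (p : Path ι) : G := pathEnd p.start p.edges

/-- The subgraph spanned by a path. -/
def Path.span {ι : X → G} (p : Path ι) : Sub ι where
  verts := {g | g = p.start ∨ ∃ e ∈ p.edges, g = e.src ∨ g = e.tgt}
  edges := {e | e ∈ p.edges ∨ e.inv ∈ p.edges}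
  src_mem e he := by
    rcases he with he | he
    · exact Or.inr ⟨e, he, Or.inl rfl⟩
    · exact Or.inr ⟨e.inv, he, Or.inr e.tgt_inv.symm⟩
  tgt_mem e he := by
    rcases he with he | he
    · exact Or.inr ⟨e, he, Or.inr rfl⟩
    · exact Or.inr ⟨e.inv, he, Or.inl rfl⟩
  inv_mem e he := by
    rcases he with he | he
    · exact Or.inr (by rwa [Edge.inv_inv])
    · exact Or.inl he

/-- The edges of the path with initial vertex `g` and label `w`. -/
def edgesFrom (ι : X → G) : G → Word X → List (Edge ι)
  | _, [] => []
  | g, a :: w => ⟨g, a⟩ :: edgesFrom ι (g * letterVal ι a) w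

theorem consecutive_edgesFrom (ι : X → G) (g : G) (w : Word X) :
    Consecutive g (edgesFrom ι g w) := by
  induction w generalizing g with
  | nil => trivial
  | cons a w ih => exact ⟨rfl, ih _⟩

/-- The path with initial vertex `g` and label `w`. -/
def pathFrom (ι : X → G) (g : G) (w : Word X) : Path ι :=
  ⟨g, edgesFrom ι g w, consecutive_edgesFrom ι g w⟩

theorem pathFrom_finish (ι : X → G) (g : G) (w : Word X) :
    (pathFrom ι g w).finish = g * wordVal ι w := by
  change pathEnd g (edgesFrom ι g w) = _
  induction w generalizing g with
  | nil => simp [edgesFrom, pathEnd, wordVal]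
  | cons a w ih =>
    change pathEnd (g * letterVal ι a) (edgesFrom ι (g * letterVal ι a) w) = _
    rw [ih]
    simp [wordVal, mul_assoc]

/-- A journey: a non-empty sequence of paths, with jumps between them. A trivial jump (the next path
starts where the previous one ends) is allowed and means that the two paths are concatenated; this
changes neither the end points of a journey nor the subgraph that it spans. -/
structure Journey (ι : X → G) : Type (max u v) where
  first : Path ι
  rest : List (Path ι)

/-- The initial vertex of a journey. -/
def Journey.start {ι : X → G} (j : Journey ι) : G := j.first.start

/-- The terminal vertex of a journey, that is, of its last path. -/
def Journey.finish {ι : X → G} (j : Journey ι) : G :=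
  ((j.first :: j.rest).getLast (List.cons_ne_nil _ _)).finish

/-- The subgraph spanned by a journey. -/
def Journey.span {ι : X → G} (j : Journey ι) : Sub ι := ⨆ p ∈ j.first :: j.rest, p.span

/-- The paths labeled by `u₁, …, uₙ` in the journey labeled by `u₀ v₁ᵐ u₁ ⋯ vₙᵐ uₙ`, when the path
labeled by `u₀` ends at `h`. -/
def tailPaths (ι : X → G) : G → List (Word X × Word X) → List (Path ι)
  | _, [] => []
  | h, p :: t =>
    pathFrom ι (h * wordVal ι p.1) p.2 :: tailPaths ι (h * wordVal ι p.1 * wordVal ι p.2) t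

/-- The journey with initial vertex `g` and label `w`. -/
def journeyFrom (ι : X → G) (g : G) (w : ImTerm X) : Journey ι :=
  ⟨pathFrom ι g w.head, tailPaths ι (g * wordVal ι w.head) w.tail⟩

theorem journeyFrom_finish (ι : X → G) (g : G) (w : ImTerm X) :
    (journeyFrom ι g w).finish = g * w.valG ι := by
  have key : ∀ (t : List (Word X × Word X)) (g : G) (u : Word X),
      ((pathFrom ι g u :: tailPaths ι (g * wordVal ι u) t).getLast
        (List.cons_ne_nil _ _)).finish =
      g * (wordVal ι u * (t.map fun p => id (wordVal ι p.1) * wordVal ι p.2).prod) := by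
    intro t
    induction t with
    | nil => intro g u; simp [tailPaths, pathFrom_finish]
    | cons p t ih =>
      intro g u
      have h := ih (g * wordVal ι u * wordVal ι p.1) p.2
      simp only [tailPaths, List.getLast_cons (List.cons_ne_nil _ _)]
      rw [h]
      simp [mul_assoc]
  exact key w.tail g w.head

/-- The term `u` labels a journey from `g` to `h` in the subgraph `D`. (The Cayley graph is
deterministic, so there is exactly one journey in it with initial vertex `g` and label `u`.) -/
def LabelsJourney {ι : X → G} (D : Sub ι) (u : ImTerm X) (g h : G) : Prop :=
  (journeyFrom ι g u).finish = h ∧ (journeyFrom ι g u).span ≤ D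

/-! ### Closure operators and expansions -/

/-- The closed subgraphs for the relation `R` on terms. -/
def IsClosedFor {ι : X → G} (R : ImTerm X → ImTerm X → Prop) (D : Sub ι) : Prop :=
  ∀ u v, R u v → ∀ g ∈ D.verts, ∀ h ∈ D.verts, LabelsJourney D u g h ↔ LabelsJourney D v g h

theorem isClosedFor_sInf {ι : X → G} {R : ImTerm X → ImTerm X → Prop}
    (hR : ∀ u v, R u v → u.valG ι = v.valG ι) (A : Set (Sub ι))
    (hA : ∀ D ∈ A, IsClosedFor R D) : IsClosedFor R (sInf A) := by
  intro u v huv g hg h hh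
  have hfin : (journeyFrom ι g u).finish = (journeyFrom ι g v).finish := by
    rw [journeyFrom_finish, journeyFrom_finish, hR u v huv]
  have hD := fun D (hD : D ∈ A) => hA D hD u v huv g (hg D hD) h (hh D hD)
  constructor
  · rintro ⟨h1, h2⟩
    exact ⟨hfin ▸ h1, le_sInf fun D hDA => ((hD D hDA).1 ⟨h1, h2.trans (sInf_le hDA)⟩).2⟩
  · rintro ⟨h1, h2⟩
    exact ⟨hfin ▸ h1, le_sInf fun D hDA => ((hD D hDA).2 ⟨h1, h2.trans (sInf_le hDA)⟩).2⟩

/-- The closure operator `c_R` on the subgraphs of the Cayley graph of `G`, where `R` is a relation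
on terms such that related terms are equal in `G`. -/
def closureOp {ι : X → G} (R : ImTerm X → ImTerm X → Prop)
    (hR : ∀ u v, R u v → u.valG ι = v.valG ι) : ClosureOperator (Sub ι) :=
  ClosureOperator.ofCompletePred (IsClosedFor R) (isClosedFor_sInf hR)

/-- The full `P`-expansion of `D` with respect to `R`: for all `(u, v)` in `R` and each journey in
`D` labeled by `u` such that the coterminal journey labeled by `v` is not in `D`, the subgraph
spanned by the latter is added. -/
def fullExpansion {ι : X → G} (R : ImTerm X → ImTerm X → Prop) (D : Sub ι) : Sub ι :=
  D ⊔ sSup {E | ∃ u v g, R u v ∧ (journeyFrom ι g u).span ≤ D ∧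
    ¬ (journeyFrom ι g v).span ≤ D ∧ E = (journeyFrom ι g v).span}

/-- The iterated full `P`-expansions of `D` with respect to `R`. -/
def iterExpansion {ι : X → G} (R : ImTerm X → ImTerm X → Prop) (D : Sub ι) : ℕ → Sub ι
  | 0 => D
  | i + 1 => fullExpansion R (iterExpansion R D i)

end Cayley

/-! ### F-Schützenberger graphs -/

section Schutz

variable {X : Type u} {S : Type v} [FInverseMonoid S]

/-- Two terms have the same value in `S`. -/
def EqIn (ι : X → S) (u v : ImTerm X) : Prop := u.valS ι = v.valS ι

theorem EqIn.valG_eq (ι : X → S) (u v : ImTerm X) (h : EqIn ι u v) :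
    u.valG (groupGen ι) = v.valG (groupGen ι) := by
  rw [valG_groupGen, valG_groupGen, show u.valS ι = v.valS ι from h]

/-- The closure operator `c_S` on the subgraphs of the Cayley graph of the greatest group image. -/
def closureOpS (ι : X → S) : ClosureOperator (Sub (groupGen ι)) :=
  closureOp (EqIn ι) (EqIn.valG_eq ι)

/-- The `F`-Schützenberger graph of a term. -/
def FSchutz (ι : X → S) (w : ImTerm X) : Sub (groupGen ι) :=
  closureOpS ι (journeyFrom (groupGen ι) 1 w).span

end Schutz

/-- The closure operator `c_R` on the subgraphs of the Cayley graph of the greatest group image of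
`FInv⟨X | R⟩`. -/
def closureOpR {X : Type u} (R : ImTerm X → ImTerm X → Prop) :
    ClosureOperator (Sub (groupGen (FInv.gen R))) :=
  closureOp R FInv.valG_eq

end FInvPres

/-! Everything follows from one fact: a subgraph `D` is closed for `c_S` exactly when it is closed
for `c_R` (`isClosedFor_eqIn_iff`). One direction is clear, since the relations in `R` hold in `S`.
For the other, let every term `s` in the full signature act on the vertices of `D` by right
translation by its value in `G`, restricted to the domain `FTerm.dom D s`. Generators act along the
edges of `D`, and `ᵐ` enlarges a domain to all vertices that the translation keeps inside `D`. The
domain of a term from `ImTerm` is the set of starting points of its journeys in `D`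
(`FTerm.mem_dom_ofIm`), so closedness for `R` says precisely that related terms have equal domains.
The laws of `F`-inverse monoids hold for pairs of a group value and such a domain, so induction on
derivations (`FTerm.dom_eq`) extends this to all pairs of terms with equal value in `S`.

The description by expansions rests on finiteness: a journey uses finitely many vertices and edges,
so in the union of the increasing stages it already lies in a single stage
(`Journey.exists_span_le`), and the next stage contains its partner. Hence the union is closed, and
every closed subgraph that contains stage 0 contains all stages. -/

namespace FInvPres

/-! ### Paths and journeys inside a subgraph -/

section Cayley

variable {X : Type u} {G : Type v} [Group G] {ι : X → G}

/-- The starting vertex matters only for the empty path; in all other cases the closure properties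
of `D` supply the vertices and inverse edges. -/
theorem Path.span_le_iff {p : Path ι} {D : Sub ι} :
    p.span ≤ D ↔ p.start ∈ D.verts ∧ ∀ e ∈ p.edges, e ∈ D.edges := by
  constructor
  · intro h
    exact ⟨h.1 (Or.inl rfl), fun e he => h.2 (Or.inl he)⟩
  · rintro ⟨h1, h2⟩
    refine ⟨?_, ?_⟩
    · rintro g (rfl | ⟨e, he, rfl | rfl⟩)
      · exact h1
      · exact D.src_mem e (h2 e he)
      · exact D.tgt_mem e (h2 e he)
    · rintro e (he | he)
      · exact h2 e he
      · have := D.inv_mem _ (h2 _ he)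
        rwa [Edge.inv_inv] at this

theorem Path.start_mem_of_span_le {p : Path ι} {D : Sub ι} (h : p.span ≤ D) :
    p.start ∈ D.verts :=
  (Path.span_le_iff.1 h).1

/-- The first edge brings its own source, so no separate condition on `g` remains. This is the
recursion for inductions on words. -/
theorem pathFrom_cons_span_le_iff {D : Sub ι} {g : G} {a : Letter X} {w : Word X} :
    (pathFrom ι g (a :: w)).span ≤ D ↔
      (⟨g, a⟩ : Edge ι) ∈ D.edges ∧ (pathFrom ι (g * letterVal ι a) w).span ≤ D := by
  simp only [Path.span_le_iff, pathFrom, edgesFrom, List.mem_cons, forall_eq_or_imp]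
  exact ⟨fun ⟨_, h1, h2⟩ => ⟨h1, D.tgt_mem _ h1, h2⟩,
    fun ⟨h1, _, h2⟩ => ⟨D.src_mem _ h1, h1, h2⟩⟩

theorem mul_wordVal_mem_of_span_le {D : Sub ι} {g : G} {w : Word X}
    (h : (pathFrom ι g w).span ≤ D) : g * wordVal ι w ∈ D.verts := by
  induction w generalizing g with
  | nil => simpa [wordVal] using show g ∈ D.verts from Path.start_mem_of_span_le h
  | cons a w ih =>
    have := ih (pathFrom_cons_span_le_iff.1 h).2
    simpa [wordVal, mul_assoc] using this

theorem Journey.span_le_iff {j : Journey ι} {D : Sub ι} :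
    j.span ≤ D ↔ ∀ p ∈ j.first :: j.rest, p.span ≤ D := by
  rw [Journey.span, iSup₂_le_iff]

theorem journeyFrom_start_mem {D : Sub ι} {g : G} {u : ImTerm X}
    (h : (journeyFrom ι g u).span ≤ D) : g ∈ D.verts :=
  Path.start_mem_of_span_le (Journey.span_le_iff.1 h _ List.mem_cons_self)

/-- `hh` covers the empty tail. The `id` is the interpretation of `ᵐ` in a group, kept so that the
product matches the one in `ImTerm.valG`. -/
theorem tailPaths_finish_mem {D : Sub ι} {h : G} {t : List (Word X × Word X)}
    (hh : h ∈ D.verts) (ht : ∀ p ∈ tailPaths ι h t, p.span ≤ D) :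
    h * (t.map fun p => id (wordVal ι p.1) * wordVal ι p.2).prod ∈ D.verts := by
  induction t generalizing h with
  | nil => simpa using hh
  | cons p t ih =>
    simp only [tailPaths, List.mem_cons, forall_eq_or_imp] at ht
    have := ih (mul_wordVal_mem_of_span_le ht.1) ht.2
    simpa [mul_assoc] using this

theorem journeyFrom_finish_mem {D : Sub ι} {g : G} {u : ImTerm X}
    (h : (journeyFrom ι g u).span ≤ D) : g * u.valG ι ∈ D.verts := by
  have h' := Journey.span_le_iff.1 h
  simp only [journeyFrom, List.mem_cons, forall_eq_or_imp] at h'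
  have := tailPaths_finish_mem (mul_wordVal_mem_of_span_le h'.1) h'.2
  rwa [mul_assoc] at this

/-- Closedness does not depend on the end points of the journeys. -/
theorem isClosedFor_iff {R : ImTerm X → ImTerm X → Prop}
    (hR : ∀ u v, R u v → u.valG ι = v.valG ι) {D : Sub ι} :
    IsClosedFor R D ↔
      ∀ u v, R u v → ∀ g, (journeyFrom ι g u).span ≤ D ↔ (journeyFrom ι g v).span ≤ D := by
  constructor
  · intro h u v huv g
    constructor
    · intro hu
      exact ((h u v huv g (journeyFrom_start_mem hu) _ (journeyFrom_finish_mem hu)).1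
        ⟨journeyFrom_finish _ _ _, hu⟩).2
    · intro hv
      exact ((h u v huv g (journeyFrom_start_mem hv) _ (journeyFrom_finish_mem hv)).2
        ⟨journeyFrom_finish _ _ _, hv⟩).2
  · intro h u v huv g _ k _
    -- Both journeys end at the same vertex because `u` and `v` agree in `G`, so only the spans need
    -- comparing.
    simp only [LabelsJourney, journeyFrom_finish, hR u v huv, h u v huv g]

/-! ### Iterated expansions -/

theorem le_fullExpansion (R : ImTerm X → ImTerm X → Prop) (D : Sub ι) :
    D ≤ fullExpansion R D :=
  le_sup_left

/-- The expansion adds only spans not yet in `D`; the case split shows that this restriction loses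
nothing. -/
theorem span_le_fullExpansion {R : ImTerm X → ImTerm X → Prop} {D : Sub ι} {u v : ImTerm X}
    (huv : R u v) {g : G} (hu : (journeyFrom ι g u).span ≤ D) :
    (journeyFrom ι g v).span ≤ fullExpansion R D := by
  by_cases hv : (journeyFrom ι g v).span ≤ D
  · exact hv.trans (le_fullExpansion R D)
  · exact le_sup_of_le_right (le_sSup ⟨u, v, g, huv, hu, hv, rfl⟩)

/-- Each added span is the partner of a journey in `D`, hence of one in `E`, and `E` is closed. -/
theorem fullExpansion_le {R : ImTerm X → ImTerm X → Prop}
    (hR : ∀ u v, R u v → u.valG ι = v.valG ι) {D E : Sub ι}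
    (hE : IsClosedFor R E) (hDE : D ≤ E) : fullExpansion R D ≤ E := by
  refine sup_le hDE (sSup_le ?_)
  rintro _ ⟨u, v, g, huv, hu, -, rfl⟩
  exact ((isClosedFor_iff hR).1 hE u v huv g).1 (hu.trans hDE)

theorem iterExpansion_mono (R : ImTerm X → ImTerm X → Prop) (D : Sub ι) :
    Monotone (iterExpansion R D) :=
  monotone_nat_of_le_succ fun _ => le_fullExpansion R _

theorem iterExpansion_le {R : ImTerm X → ImTerm X → Prop}
    (hR : ∀ u v, R u v → u.valG ι = v.valG ι) {D E : Sub ι}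
    (hE : IsClosedFor R E) (hDE : D ≤ E) (i : ℕ) : iterExpansion R D i ≤ E := by
  induction i with
  | zero => exact hDE
  | succ i ih => exact fullExpansion_le hR hE ih

/-- Finitely many indices have a maximum. It serves both for the edges of a path and for the paths
of a journey. -/
theorem exists_forall_mem_of_monotone {α : Type*} {P : ℕ → α → Prop} (hP : Monotone P)
    {l : List α} (h : ∀ a ∈ l, ∃ i, P i a) : ∃ i, ∀ a ∈ l, P i a := by
  induction l with
  | nil => exact ⟨0, by simp⟩
  | cons a l ih =>
    obtain ⟨i, hi⟩ := h a List.mem_cons_self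
    obtain ⟨j, hj⟩ := ih fun b hb => h b (List.mem_cons_of_mem _ hb)
    refine ⟨max i j, fun b hb => ?_⟩
    rcases List.mem_cons.1 hb with rfl | hb
    · exact hP (le_max_left i j) _ hi
    · exact hP (le_max_right i j) _ (hj b hb)

theorem Sub.mem_verts_iSup {κ : Type*} {D : κ → Sub ι} {g : G} :
    g ∈ (⨆ i, D i).verts ↔ ∃ i, g ∈ (D i).verts := by
  change (∃ E ∈ Set.range D, g ∈ E.verts) ↔ _
  simp

theorem Sub.mem_edges_iSup {κ : Type*} {D : κ → Sub ι} {e : Edge ι} :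
    e ∈ (⨆ i, D i).edges ↔ ∃ i, e ∈ (D i).edges := by
  change (∃ E ∈ Set.range D, e ∈ E.edges) ↔ _
  simp

/-- A path in the union of a chain of subgraphs lies in one of them. -/
theorem Path.exists_span_le {D : ℕ → Sub ι} (hD : Monotone D) {p : Path ι}
    (hp : p.span ≤ ⨆ i, D i) : ∃ i, p.span ≤ D i := by
  obtain ⟨h1, h2⟩ := Path.span_le_iff.1 hp
  obtain ⟨i, hi⟩ := Sub.mem_verts_iSup.1 h1
  obtain ⟨j, hj⟩ := exists_forall_mem_of_monotone (P := fun i e => e ∈ (D i).edges)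
    (fun _ _ hij _ he => (hD hij).2 he) fun e he => Sub.mem_edges_iSup.1 (h2 e he)
  exact ⟨max i j, Path.span_le_iff.2 ⟨(hD (le_max_left i j)).1 hi,
    fun e he => (hD (le_max_right i j)).2 (hj e he)⟩⟩

/-- A journey in the union of a chain of subgraphs lies in one of them. -/
theorem Journey.exists_span_le {D : ℕ → Sub ι} (hD : Monotone D) {j : Journey ι}
    (hj : j.span ≤ ⨆ i, D i) : ∃ i, j.span ≤ D i := by
  obtain ⟨i, hi⟩ := exists_forall_mem_of_monotone (P := fun i (p : Path ι) => p.span ≤ D i)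
    (fun _ _ hij _ hp => hp.trans (hD hij))
    fun p hp => Path.exists_span_le hD (Journey.span_le_iff.1 hj p hp)
  exact ⟨i, Journey.span_le_iff.2 hi⟩

/-- A journey in the union lies in some stage `i`, so its partner lies in stage `i + 1`. Expansions
follow pairs from left to right only; symmetry of the relation gives the converse. -/
theorem isClosedFor_iSup_iterExpansion {R : ImTerm X → ImTerm X → Prop}
    (hR : ∀ u v, R u v → u.valG ι = v.valG ι) (hsymm : ∀ u v, R u v → R v u) (D : Sub ι) :
    IsClosedFor R (⨆ i, iterExpansion R D i) := by
  have key : ∀ u v, R u v → ∀ g, (journeyFrom ι g u).span ≤ ⨆ i, iterExpansion R D i →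
      (journeyFrom ι g v).span ≤ ⨆ i, iterExpansion R D i := by
    intro u v huv g hu
    obtain ⟨i, hi⟩ := Journey.exists_span_le (iterExpansion_mono R D) hu
    exact (span_le_fullExpansion huv hi).trans (le_iSup (iterExpansion R D) (i + 1))
  exact (isClosedFor_iff hR).2 fun u v huv g => ⟨key u v huv g, key v u (hsymm u v huv) g⟩

theorem closureOp_eq_iSup_iterExpansion {R : ImTerm X → ImTerm X → Prop}
    (hR : ∀ u v, R u v → u.valG ι = v.valG ι) (hsymm : ∀ u v, R u v → R v u) (D : Sub ι) :
    closureOp R hR D = ⨆ (i : ℕ) (_ : 1 ≤ i), iterExpansion R D i := by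
  -- Starting the union at index 1 is harmless, since each stage, stage 0 included, is contained in
  -- its successor.
  have hU : (⨆ (i : ℕ) (_ : 1 ≤ i), iterExpansion R D i) = ⨆ i, iterExpansion R D i := by
    refine le_antisymm (iSup₂_le fun i _ => le_iSup (iterExpansion R D) i) (iSup_le fun i => ?_)
    exact (iterExpansion_mono R D i.le_succ).trans
      (le_iSup₂ (f := fun (i : ℕ) (_ : 1 ≤ i) => iterExpansion R D i) (i + 1) (by omega))
  rw [hU]
  refine le_antisymm ?_ (iSup_le fun i => ?_)
  · exact ClosureOperator.closure_min (le_iSup (iterExpansion R D) 0)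
      (show (closureOp R hR).IsClosed _ from isClosedFor_iSup_iterExpansion hR hsymm D)
  · exact iterExpansion_le hR ((closureOp R hR).isClosed_closure D)
      ((closureOp R hR).le_closure D) i

end Cayley

/-! ### The action of terms on a subgraph -/

section Action

variable {X : Type u} {R : ImTerm X → ImTerm X → Prop}

/-- The value of a term in the greatest group image. -/
def FTerm.valG (R : ImTerm X → ImTerm X → Prop) (s : FTerm X) : GroupImage (FInv R) :=
  toGroupImage (FInv.mk R s)

theorem FTerm.valG_eq {s t : FTerm X} (h : FInvRel R s t) : s.valG R = t.valG R :=
  congrArg toGroupImage (Quotient.sound h)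

theorem FTerm.valG_one : (FTerm.one : FTerm X).valG R = 1 := rfl

theorem FTerm.valG_mul (s t : FTerm X) : (FTerm.mul s t).valG R = s.valG R * t.valG R := rfl

theorem FTerm.valG_inv (s : FTerm X) : (FTerm.inv s).valG R = (s.valG R)⁻¹ := rfl

theorem FTerm.valG_m (s : FTerm X) : (FTerm.m s).valG R = s.valG R :=
  toGroupImage_m (FInv.mk R s)

theorem FTerm.valG_ofWord (w : Word X) :
    (FTerm.ofWord w).valG R = wordVal (groupGen (FInv.gen R)) w := by
  rw [FTerm.valG, FInv.mk_ofWord, wordVal_groupGen]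

/-- A term acts on the vertices of `D` by a partial right translation; this is its domain. Edges
of `D` act for the generators, and `ᵐ` extends a partial translation as far as `D` permits. -/
def FTerm.dom (D : Sub (groupGen (FInv.gen R))) : FTerm X → Set (GroupImage (FInv R))
  | .var x => {g | (⟨g, (x, true)⟩ : Edge (groupGen (FInv.gen R))) ∈ D.edges}
  | .one => D.verts
  | .mul s t => {g | g ∈ FTerm.dom D s ∧ g * s.valG R ∈ FTerm.dom D t}
  | .inv s => {g | g * (s.valG R)⁻¹ ∈ FTerm.dom D s}
  | .m s => {g | g ∈ D.verts ∧ g * s.valG R ∈ D.verts}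

variable {D : Sub (groupGen (FInv.gen R))}

/-- Both the domain and the image of the translation lie in `D`. This makes `D.verts` act as the
identity and makes the domain of `s` part of that of `ᵐ` applied to `s`. -/
theorem FTerm.mem_of_mem_dom {s : FTerm X} {g : GroupImage (FInv R)} (h : g ∈ s.dom D) :
    g ∈ D.verts ∧ g * s.valG R ∈ D.verts := by
  induction s generalizing g with
  | var x => exact ⟨D.src_mem _ h, D.tgt_mem _ h⟩
  | one => exact ⟨h, by rwa [FTerm.valG_one, _root_.mul_one]⟩
  | mul s t ihs iht =>
    refine ⟨(ihs h.1).1, ?_⟩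
    rw [FTerm.valG_mul, ← _root_.mul_assoc]
    exact (iht h.2).2
  | inv s ih =>
    have := ih h
    rw [inv_mul_cancel_right] at this
    -- Inverting a translation exchanges source and target.
    exact ⟨this.2, this.1⟩
  | m s => rwa [FTerm.valG_m]

/-- Together with `FTerm.valG_mul_inv`: `s` followed by its inverse acts as the identity restricted
to the domain of `s`. -/
theorem FTerm.mem_dom_mul_inv {s : FTerm X} {g : GroupImage (FInv R)} :
    g ∈ (FTerm.mul s s.inv).dom D ↔ g ∈ s.dom D := by
  simp [FTerm.dom]

theorem FTerm.valG_mul_inv (s : FTerm X) : (FTerm.mul s s.inv).valG R = 1 := by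
  simp [FTerm.valG_mul, FTerm.valG_inv]

theorem FTerm.mem_dom_mul {s t : FTerm X} {g : GroupImage (FInv R)} :
    g ∈ (FTerm.mul s t).dom D ↔ g ∈ s.dom D ∧ g * s.valG R ∈ t.dom D := Iff.rfl

theorem FTerm.mem_dom_inv {s : FTerm X} {g : GroupImage (FInv R)} :
    g ∈ (FTerm.inv s).dom D ↔ g * (s.valG R)⁻¹ ∈ s.dom D := Iff.rfl

theorem FTerm.mem_dom_ofLetter {a : Letter X} {g : GroupImage (FInv R)} :
    g ∈ (FTerm.ofLetter a).dom D ↔ (⟨g, a⟩ : Edge (groupGen (FInv.gen R))) ∈ D.edges := by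
  obtain ⟨x, _ | _⟩ := a
  -- Acting by an inverse letter means traversing an edge labeled `x` backwards, and `D` contains an
  -- edge exactly when it contains the inverse edge.
  · have he : (⟨g, (x, false)⟩ : Edge (groupGen (FInv.gen R))).inv =
        ⟨g * ((FTerm.var x).valG R)⁻¹, (x, true)⟩ := rfl
    change (⟨g * ((FTerm.var x).valG R)⁻¹, (x, true)⟩ : Edge (groupGen (FInv.gen R))) ∈ D.edges ↔ _
    rw [← he]
    refine ⟨fun h => ?_, D.inv_mem _⟩
    have := D.inv_mem _ h
    rwa [Edge.inv_inv] at this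
  · rfl

theorem FTerm.valG_ofLetter (a : Letter X) :
    (FTerm.ofLetter a).valG R = letterVal (groupGen (FInv.gen R)) a := by
  obtain ⟨x, _ | _⟩ := a <;> rfl

theorem FTerm.mem_dom_ofWord {w : Word X} {g : GroupImage (FInv R)} :
    g ∈ (FTerm.ofWord w).dom D ↔ (pathFrom (groupGen (FInv.gen R)) g w).span ≤ D := by
  induction w generalizing g with
  | nil => simp [FTerm.ofWord, FTerm.dom, Path.span_le_iff, pathFrom, edgesFrom]
  | cons a w ih =>
    rw [pathFrom_cons_span_le_iff, ← ih, ← FTerm.mem_dom_ofLetter, ← FTerm.valG_ofLetter]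
    rfl

/-- The factor from `ᵐ` only asks both ends of a jump to be vertices of `D`: one is `g`, the other
starts the next path. So jumps impose no condition beyond the paths themselves. -/
theorem FTerm.mem_dom_ofTail {t : List (Word X × Word X)} {g : GroupImage (FInv R)}
    (hg : g ∈ D.verts) :
    g ∈ (FTerm.ofTail t).dom D ↔
      ∀ p ∈ tailPaths (groupGen (FInv.gen R)) g t, p.span ≤ D := by
  induction t generalizing g with
  | nil => simpa [FTerm.ofTail, FTerm.dom, tailPaths] using hg
  | cons q t ih =>
    simp only [tailPaths, List.mem_cons, forall_eq_or_imp]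
    rw [FTerm.ofTail, FTerm.mem_dom_mul, FTerm.mem_dom_mul, FTerm.valG_mul, FTerm.valG_m,
      FTerm.valG_ofWord, FTerm.valG_ofWord, FTerm.mem_dom_ofWord, ← _root_.mul_assoc]
    constructor
    · rintro ⟨⟨-, h1⟩, h2⟩
      exact ⟨h1, (ih (mul_wordVal_mem_of_span_le h1)).1 h2⟩
    · rintro ⟨h1, h2⟩
      refine ⟨⟨⟨hg, ?_⟩, h1⟩, (ih (mul_wordVal_mem_of_span_le h1)).2 h2⟩
      rw [FTerm.valG_ofWord]
      exact Path.start_mem_of_span_le h1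

/-- The bridge between the algebra of terms and the journeys that define closedness. The tail is
compared only once the head path is known to end in `D`. -/
theorem FTerm.mem_dom_ofIm {u : ImTerm X} {g : GroupImage (FInv R)} :
    g ∈ (FTerm.ofIm u).dom D ↔ (journeyFrom (groupGen (FInv.gen R)) g u).span ≤ D := by
  rw [Journey.span_le_iff, FTerm.ofIm, FTerm.mem_dom_mul, FTerm.mem_dom_ofWord, FTerm.valG_ofWord]
  simp only [journeyFrom, List.mem_cons, forall_eq_or_imp]
  exact and_congr_right fun h => FTerm.mem_dom_ofTail (mul_wordVal_mem_of_span_le h)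

/-- Terms with equal values in `FInv⟨X | R⟩` act in the same way on a closed subgraph. -/
theorem FTerm.dom_eq (hD : IsClosedFor R D) {s t : FTerm X} (h : FInvRel R s t) :
    s.dom D = t.dom D := by
  induction h with
  | refl => rfl
  | symm _ ih => exact ih.symm
  | trans _ _ ih1 ih2 => exact ih1.trans ih2
  | mul_congr h1 h2 ih1 ih2 =>
    ext g
    rw [FTerm.mem_dom_mul, FTerm.mem_dom_mul, ih1, ih2, FTerm.valG_eq h1]
  | inv_congr h ih =>
    ext g
    rw [FTerm.mem_dom_inv, FTerm.mem_dom_inv, ih, FTerm.valG_eq h]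
  -- The domain for `ᵐ` depends on the term only through its group value.
  | m_congr h ih => simp only [FTerm.dom, FTerm.valG_eq h]
  | mul_assoc s t r =>
    ext g
    simp only [FTerm.mem_dom_mul, FTerm.valG_mul, _root_.mul_assoc, and_assoc]
  | one_mul s =>
    ext g
    rw [FTerm.mem_dom_mul, FTerm.valG_one, _root_.mul_one]
    exact ⟨And.right, fun h => ⟨(FTerm.mem_of_mem_dom h).1, h⟩⟩
  | mul_one s =>
    ext g
    exact ⟨And.left, fun h => ⟨h, (FTerm.mem_of_mem_dom h).2⟩⟩
  | inv_inv s =>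
    ext g
    simp [FTerm.mem_dom_inv, FTerm.valG_inv]
  | mul_inv_rev s t =>
    ext g
    simp [FTerm.mem_dom_inv, FTerm.mem_dom_mul, FTerm.valG_inv, FTerm.valG_mul, and_comm,
      ← _root_.mul_assoc]
  | mul_inv_mul s =>
    ext g
    rw [FTerm.mem_dom_mul, FTerm.mem_dom_mul_inv, FTerm.valG_mul_inv, _root_.mul_one, and_self]
  -- Restrictions of the identity compose to the restriction to the intersection of the domains.
  | idem_comm s t =>
    ext g
    simp only [FTerm.mem_dom_mul (s := .mul _ _), FTerm.mem_dom_mul_inv, FTerm.valG_mul_inv,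
      _root_.mul_one, and_comm]
  | mul_inv_mul_m s =>
    ext g
    rw [FTerm.mem_dom_mul, FTerm.mem_dom_mul_inv, FTerm.valG_mul_inv, _root_.mul_one]
    exact ⟨And.left, fun h => ⟨h, FTerm.mem_of_mem_dom h⟩⟩
  -- The idempotent factor has group value 1, and a domain for `ᵐ` sees nothing else of its
  -- argument.
  | m_absorb s t =>
    simp only [FTerm.dom, FTerm.valG_mul (.mul _ _), FTerm.valG_mul_inv, _root_.one_mul]
  -- The only case that uses closedness of `D`; the others hold in every subgraph.
  | rel huv =>
    ext g
    rw [FTerm.mem_dom_ofIm, FTerm.mem_dom_ofIm]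
    exact (isClosedFor_iff FInv.valG_eq).1 hD _ _ huv g

/-- The closed subgraphs for `c_R` and `c_S` are the same. -/
theorem isClosedFor_eqIn_iff : IsClosedFor (EqIn (FInv.gen R)) D ↔ IsClosedFor R D := by
  rw [isClosedFor_iff (EqIn.valG_eq _)]
  constructor
  · intro h
    exact (isClosedFor_iff FInv.valG_eq).2 fun u v huv => h u v (FInv.valS_eq huv)
  · intro hD u v huv g
    have h : FInv.mk R (.ofIm u) = FInv.mk R (.ofIm v) := by
      rw [FInv.mk_ofIm, FInv.mk_ofIm]
      exact huv
    -- Equality in the quotient yields a derivation, on which `FTerm.dom_eq` runs its induction.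
    rw [← FTerm.mem_dom_ofIm, ← FTerm.mem_dom_ofIm, FTerm.dom_eq hD (Quotient.exact h)]

/-- The closure operators `c_S` and `c_R` coincide. -/
theorem closureOpS_gen (R : ImTerm X → ImTerm X → Prop) :
    closureOpS (FInv.gen R) = closureOpR R :=
  ClosureOperator.ext_isClosed _ _ fun _ => isClosedFor_eqIn_iff

end Action

end FInvPres

/-! ### The theorem -/

theorem mainTheorem4 {X : Type*} (R : FInvPres.ImTerm X → FInvPres.ImTerm X → Prop)
    (hR : ∀ u v, R u v → R v u) (w : FInvPres.ImTerm X) :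
    FInvPres.FSchutz (FInvPres.FInv.gen R) w =
      FInvPres.closureOpR R
        (FInvPres.journeyFrom (FInvPres.groupGen (FInvPres.FInv.gen R)) 1 w).span ∧
    IsLeast {D : FInvPres.Sub (FInvPres.groupGen (FInvPres.FInv.gen R)) |
        (FInvPres.closureOpR R).IsClosed D ∧
          (FInvPres.journeyFrom (FInvPres.groupGen (FInvPres.FInv.gen R)) 1 w).span ≤ D}
      (FInvPres.FSchutz (FInvPres.FInv.gen R) w) ∧
    FInvPres.FSchutz (FInvPres.FInv.gen R) w =
      ⨆ (i : ℕ) (_ : 1 ≤ i), FInvPres.iterExpansion R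
        (FInvPres.journeyFrom (FInvPres.groupGen (FInvPres.FInv.gen R)) 1 w).span i := by
  -- With `c_S` replaced by `c_R`, the first claim is definitional and the second is the general
  -- minimality of a closure.
  rw [FInvPres.FSchutz, FInvPres.closureOpS_gen]
  refine ⟨rfl, ⟨⟨ClosureOperator.isClosed_closure _ _, ClosureOperator.le_closure _ _⟩, ?_⟩, ?_⟩
  · rintro D ⟨hD, hwD⟩
    exact ClosureOperator.closure_min hwD hD
  · exact FInvPres.closureOp_eq_iSup_iterExpansion FInvPres.FInv.valG_eq hR _
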